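/- Fix a first-order language with at least one constant. Let $P$ and $R$ be general logic programs, i.e. finite sets of clauses $H\leftarrow L_1,\dots,L_n$ with $H$ an atom and the $L_i$ literals (atoms or negated atoms); a query is a finite sequence of literals. A *type* is a set of terms closed under substitution, and every argument position of every predicate symbol has a fixed mode (input or output) and a fixed type. For typed terms, $\mathbf s:\mathbf S\Rightarrow\mathbf t:\mathbf T$ means that for all substitutions $\theta$, $\mathbf s\theta\in\mathbf S$ implies $\mathbf t\theta\in\mathbf T$. A query $L_1,\dots,L_n$ is *well-typed* if for each $j$ the typed terms in the output positions of the positive literals among $L_1,\dots,L_{j-1}$ imply ($\Rightarrow$) those in the input positions of $L_j$. A clause $L_0\leftarrow L_1,\dots,L_n$ is well-typed if the typed terms in the input positions of $L_0$, together with those in the output positions of the positive literals among $L_1,\dots,L_{j-1}$, imply those in the input positions of $L_j$ for each $j\in\{1,\dots,n\}$, and, together with those in the output positions of all positive literals among $L_1,\dots,L_n$, imply those in the output positions of $L_0$. A program is well-typed if all its clauses are. Derivations are those of LDNF-resolution (leftmost selection rule, negation as failure; a query starting with a non-ground negative literal flounders and ends the derivation), and a derivation in which the construction of a subsidiary tree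 for a negative literal diverges counts as infinite. A relation is defined in a program if it occurs in the head of a clause of it, and an atom is defined in a program if its relation is. Suppose that $P\cup R$ is well-typed and that $P$ extends $R$, i.e. no relation defined in $P$ occurs in $R$. Let $M$ be a complete model of $P\cup R$: a model of $P\cup R$ whose restriction to the set $\mathrm{Neg}^*$ of relations on which the relations occurring in negative literals of clauses of $P\cup R$ depend (reflexively and transitively) is a model of Clark's completion of the set of clauses of $P\cup R$ defining a relation of $\mathrm{Neg}^*$ (relations of $\mathrm{Neg}^*$ without clauses being empty, and the completion of the empty program containing no equality axioms). Let $|\cdot|$ be a level mapping, i.e. a function from ground atoms to $\mathbb N$, extended to ground literals by $|\neg A|=|A|$. Suppose that - $P$ is acceptable with respect to $|\cdot|$ and $M$: for every ground instance $A\leftarrow\mathbf A,B,\mathbf B$ of a clause of $P$, if $M\models\mathbf A$ then $|A|>|B|$; - every well-typed atom $A$ defined in $P$ is bounded: the set of all $|A'|$ with $A'$ a ground instance of $A$ is finite; - for all well-typed queries $Q$, all LDNF-derivations of $R\cup\{Q\}$ are finite. Then for all well-typed queries $Q$, all LDNF-derivations of $(P\cup R)\cup\{Q\}$ are finite. -/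

import Mathlib

universe u v w

namespace LogicProg

/-! ### Atoms, literals, queries, clauses, programs

A first-order language `L` supplies the function symbols and the predicate symbols ("relations").
Terms are Mathlib's `L.Term α`; the variables of programs and queries are the natural numbers, and
`L.Term Empty` is the Herbrand universe. -/

/-- Atoms `p(t₁, …, tₙ)` with variables from `α`. -/
structure Atom (L : FirstOrder.Language.{u, v}) (α : Type) where
  {arity : ℕ}
  rel : L.Relations arity
  args : Fin arity → L.Term α

/-- A literal is an atom or the negation of an atom. -/
inductive Literal (L : FirstOrder.Language.{u, v}) (α : Type) where
  | pos (A : Atom L α)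
  | neg (A : Atom L α)

/-- A (general) query: a possibly empty finite sequence of literals. -/
abbrev Query (L : FirstOrder.Language.{u, v}) := List (Literal L ℕ)

/-- A (general) clause `head ← body`. -/
structure Clause (L : FirstOrder.Language.{u, v}) (α : Type) where
  head : Atom L α
  body : List (Literal L α)

/-- A set of clauses; programs are the finite ones. -/
abbrev Program (L : FirstOrder.Language.{u, v}) := Set (Clause L ℕ)

/-- The type of predicate symbols, of all arities. -/
abbrev Rel (L : FirstOrder.Language.{u, v}) := Σ n, L.Relations n

variable {L : FirstOrder.Language.{u, v}} {α β : Type}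

def Atom.symbol (A : Atom L α) : Rel L := ⟨A.arity, A.rel⟩

def Atom.subst (A : Atom L α) (θ : α → L.Term β) : Atom L β :=
  ⟨A.rel, fun i => (A.args i).subst θ⟩

/-- The variables of an atom. -/
def Atom.vars (A : Atom L ℕ) : Set ℕ := {x | ∃ i, x ∈ (A.args i).varFinset}

def Atom.IsGround (A : Atom L ℕ) : Prop := A.vars = ∅

/-- The underlying atom of a literal. -/
def Literal.atom : Literal L α → Atom L α
  | .pos A => A
  | .neg A => A

def Literal.subst : Literal L α → (α → L.Term β) → Literal L β
  | .pos A, θ => .pos (A.subst θ)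
  | .neg A, θ => .neg (A.subst θ)

def Clause.subst (c : Clause L α) (θ : α → L.Term β) : Clause L β :=
  ⟨c.head.subst θ, c.body.map fun l => l.subst θ⟩

/-- The variables of a query. -/
def queryVars (Q : Query L) : Set ℕ := {x | ∃ l ∈ Q, x ∈ l.atom.vars}

/-- The variables of a clause. -/
def Clause.vars (c : Clause L ℕ) : Set ℕ := c.head.vars ∪ queryVars c.body

/-- The variant of a clause obtained by a permutation of the variables. -/
def Clause.rename (c : Clause L ℕ) (e : Equiv.Perm ℕ) : Clause L ℕ :=
  c.subst fun x => FirstOrder.Language.Term.var (e x)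

/-! ### LDNF-resolution -/

/-- `σ` is a most general unifier of `A` and `B`. -/
def IsMGU (σ : ℕ → L.Term ℕ) (A B : Atom L ℕ) : Prop :=
  A.subst σ = B.subst σ ∧
    ∀ τ : ℕ → L.Term ℕ, A.subst τ = B.subst τ → ∃ ρ : ℕ → L.Term ℕ, ∀ x, τ x = (σ x).subst ρ

/-- `Q'` is a resolvent of the query `A, Q` (whose first literal, the atom `A`, is selected) and a
clause of `P`: some variant of the clause, having no variable in common with `A, Q`, has a head
that unifies with `A`. -/
def Resolvent (P : Program L) (A : Atom L ℕ) (Q Q' : Query L) : Prop :=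
  ∃ c ∈ P, ∃ (e : Equiv.Perm ℕ) (σ : ℕ → L.Term ℕ),
    Disjoint (c.rename e).vars (queryVars (.pos A :: Q)) ∧
    IsMGU σ A (c.rename e).head ∧
    Q' = ((c.rename e).body ++ Q).map fun l => l.subst σ

inductive Outcome where
  | success
  | failure

/-- The outcome of LDNF-trees. `HasOutcome P .success Q`: the LDNF-tree of `P ∪ {Q}` contains a
success node (an empty query). `HasOutcome P .failure Q`: it is finitely failed, that is, finite
with all leaves failed. A query `¬A, Q` with `A` ground fails if the subsidiary tree of `A`
contains a success node, and has the single child `Q` if that tree is finitely failed; a query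
`¬A, Q` with `A` not ground is a floundering leaf, neither successful nor failed. Resolvents are
unique up to renaming once the clause is chosen, so that it does not matter that all of them are
taken into account. -/
inductive HasOutcome (P : Program L) : Outcome → Query L → Prop where
  | success_nil : HasOutcome P .success []
  | success_pos {A : Atom L ℕ} {Q Q' : Query L} :
      Resolvent P A Q Q' → HasOutcome P .success Q' → HasOutcome P .success (.pos A :: Q)
  | success_neg {A : Atom L ℕ} {Q : Query L} :
      A.IsGround → HasOutcome P .failure [.pos A] → HasOutcome P .success Q →
        HasOutcome P .success (.neg A :: Q)
  | failure_pos {A : Atom L ℕ} {Q : Query L} :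
      (∀ Q', Resolvent P A Q Q' → HasOutcome P .failure Q') → HasOutcome P .failure (.pos A :: Q)
  | failure_neg {A : Atom L ℕ} {Q : Query L} :
      A.IsGround → HasOutcome P .success [.pos A] → HasOutcome P .failure (.neg A :: Q)
  | failure_neg_next {A : Atom L ℕ} {Q : Query L} :
      A.IsGround → HasOutcome P .failure [.pos A] → HasOutcome P .failure Q →
        HasOutcome P .failure (.neg A :: Q)

/-- One step of the interpreter: resolve the first literal if it is an atom; if it is `¬A` with `A`
ground, open the subsidiary tree of `A`, or pass to the rest of the query if that tree is finitely
failed. There is no step from the empty query, from a floundering query, or from an atom without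
resolvents. -/
inductive Step (P : Program L) : Query L → Query L → Prop where
  | resolve {A : Atom L ℕ} {Q Q' : Query L} : Resolvent P A Q Q' → Step P (.pos A :: Q) Q'
  | subsidiary {A : Atom L ℕ} {Q : Query L} : A.IsGround → Step P (.neg A :: Q) [.pos A]
  | next {A : Atom L ℕ} {Q : Query L} :
      A.IsGround → HasOutcome P .failure [.pos A] → Step P (.neg A :: Q) Q

/-- All LDNF-derivations of `P ∪ {Q}` are finite, where a derivation in which the construction of a
subsidiary tree diverges (has an infinite branch, or leads to an infinite nesting of subsidiary
trees) counts as infinite. -/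
def AllDerivationsFinite (P : Program L) (Q : Query L) : Prop :=
  ¬ ∃ f : ℕ → Query L, f 0 = Q ∧ ∀ n, Step P (f n) (f (n + 1))

/-! ### Relations of a program, extension -/

/-- The relation `p` is defined in `P`: it occurs in the head of a clause of `P`. -/
def DefinedIn (P : Program L) (p : Rel L) : Prop := ∃ c ∈ P, c.head.symbol = p

/-- The relation `p` occurs in `P`. -/
def OccursIn (P : Program L) (p : Rel L) : Prop :=
  ∃ c ∈ P, c.head.symbol = p ∨ ∃ l ∈ c.body, l.atom.symbol = p

/-- `P` extends `R`: no relation defined in `P` occurs in `R`. -/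
def Extends (P R : Program L) : Prop := ∀ p, DefinedIn P p → ¬ OccursIn R p

/-- `p` refers to `q` in `P`. -/
def RefersTo (P : Program L) (p q : Rel L) : Prop :=
  ∃ c ∈ P, c.head.symbol = p ∧ ∃ l ∈ c.body, l.atom.symbol = q

/-- `p` depends on `q` in `P`. -/
def DependsOn (P : Program L) : Rel L → Rel L → Prop := Relation.ReflTransGen (RefersTo P)

/-- The relations occurring in a negative literal of a clause of `P`. -/
def NegRels (P : Program L) : Set (Rel L) :=
  {p | ∃ c ∈ P, ∃ A, Literal.neg A ∈ c.body ∧ A.symbol = p}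

/-- The relations on which the relations in `NegRels P` depend. -/
def NegStar (P : Program L) : Set (Rel L) := {q | ∃ p ∈ NegRels P, DependsOn P p q}

/-- The clauses of `P` defining a relation of `NegStar P`. -/
def NegPart (P : Program L) : Program L := {c ∈ P | c.head.symbol ∈ NegStar P}

/-! ### Models

An interpretation is a (not necessarily Herbrand) structure for the language, with domain `D`. -/

/-- Clark's free equality axioms: distinct function symbols have disjoint ranges, function symbols
are injective, and no term other than `x` containing the variable `x` ever equals `x`. -/
def FreeEquality (L : FirstOrder.Language.{u, v}) (D : Type w) [L.Structure D] : Prop :=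
  (∀ (n m : ℕ) (f : L.Functions n) (g : L.Functions m) (a : Fin n → D) (b : Fin m → D),
    FirstOrder.Language.Structure.funMap f a = FirstOrder.Language.Structure.funMap g b →
      (⟨n, f, a⟩ : Σ k, L.Functions k × (Fin k → D)) = ⟨m, g, b⟩) ∧
  (∀ (x : ℕ) (t : L.Term ℕ), x ∈ t.varFinset → t ≠ FirstOrder.Language.Term.var x →
    ∀ s : ℕ → D, t.realize s ≠ s x)

section Models

variable (D : Type w) [L.Structure D]

def Atom.Holds (A : Atom L α) (s : α → D) : Prop :=
  FirstOrder.Language.Structure.RelMap A.rel fun i => (A.args i).realize s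

def Literal.Holds : Literal L α → (α → D) → Prop
  | .pos A, s => A.Holds D s
  | .neg A, s => ¬ A.Holds D s

/-- The interpretation is a model of (the universal closure of) every clause of `P`. -/
def IsModel (P : Program L) : Prop :=
  ∀ c ∈ P, ∀ s : ℕ → D, (∀ l ∈ c.body, l.Holds D s) → c.head.Holds D s

/-- The restriction of the interpretation to the relations in `S` is a model of Clark's completion
of the program `P`, in the language whose relations are those in `S`: for every `p ∈ S`, `p(d)`
holds iff it is the head of an instance of a clause of `P` with a true body (so `p` is empty if no
clause of `P` defines it), and the free equality axioms hold. The equality axioms of the empty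
program are void. -/
def IsModelOfCompletion (P : Program L) (S : Set (Rel L)) : Prop :=
  (P.Nonempty → FreeEquality L D) ∧
  ∀ (n : ℕ) (p : L.Relations n), (⟨n, p⟩ : Rel L) ∈ S → ∀ d : Fin n → D,
    (FirstOrder.Language.Structure.RelMap p d ↔
      ∃ c ∈ P, ∃ s : ℕ → D,
        (⟨c.head.arity, c.head.rel, fun i => (c.head.args i).realize s⟩ :
          Σ k, L.Relations k × (Fin k → D)) = ⟨n, p, d⟩ ∧
        ∀ l ∈ c.body, l.Holds D s)

/-- Complete model of `P`. -/
def IsCompleteModel (P : Program L) : Prop :=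
  IsModel D P ∧ IsModelOfCompletion D (NegPart P) (NegStar P)

end Models

/-! ### Level mappings, acceptability, boundedness -/

/-- A level mapping: a function from the Herbrand base to the natural numbers. The level of a ground
literal is that of its atom. -/
abbrev LevelMapping (L : FirstOrder.Language.{u, v}) := Atom L Empty → ℕ

/-- The inequality of acceptability: for every ground instance `A ← B₁, B, B₂` of a clause of `P`,
if all literals in `B₁` are true in the interpretation, then `|A| > |B|`. -/
def Acceptable (D : Type w) [L.Structure D] (P : Program L) (level : LevelMapping L) : Prop :=
  ∀ c ∈ P, ∀ γ : ℕ → L.Term Empty, ∀ (B₁ : List (Literal L Empty)) (B : Literal L Empty)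
    (B₂ : List (Literal L Empty)),
    (c.subst γ).body = B₁ ++ B :: B₂ →
    (∀ l ∈ B₁, l.Holds D (fun x : Empty => x.elim)) →
    level B.atom < level (c.subst γ).head

/-- The set of the levels of the ground instances of `A` is finite. -/
def Bounded (level : LevelMapping L) (A : Atom L ℕ) : Prop :=
  {k | ∃ γ : ℕ → L.Term Empty, k = level (A.subst γ)}.Finite

/-! ### Well-typedness -/

/-- A type is a set of terms closed under substitution. -/
structure TermType (L : FirstOrder.Language.{u, v}) where
  carrier : Set (L.Term ℕ)
  subst_mem : ∀ t ∈ carrier, ∀ θ : ℕ → L.Term ℕ, t.subst θ ∈ carrier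

inductive Mode where
  | input
  | output

/-- A fixed mode and a fixed type for every argument position of every relation. -/
structure Typing (L : FirstOrder.Language.{u, v}) where
  mode : ∀ {n : ℕ}, L.Relations n → Fin n → Mode
  type : ∀ {n : ℕ}, L.Relations n → Fin n → TermType L

/-- Typed terms `t : T`. -/
abbrev TypedTerm (L : FirstOrder.Language.{u, v}) := L.Term ℕ × TermType L

/-- The type judgement `Γ ⇒ Δ` is true. -/
def JudgementTrue (Γ Δ : Set (TypedTerm L)) : Prop :=
  ∀ θ : ℕ → L.Term ℕ, (∀ a ∈ Γ, a.1.subst θ ∈ a.2.carrier) → ∀ a ∈ Δ, a.1.subst θ ∈ a.2.carrier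

/-- The typed terms filling in the positions of `A` with mode `m`. -/
def Typing.positions (τ : Typing L) (m : Mode) (A : Atom L ℕ) : Set (TypedTerm L) :=
  {a | ∃ i, τ.mode A.rel i = m ∧ a = (A.args i, τ.type A.rel i)}

/-- The typed terms filling in the output positions of the positive literals of `Q`. -/
def Typing.posOutputs (τ : Typing L) (Q : Query L) : Set (TypedTerm L) :=
  {a | ∃ A, Literal.pos A ∈ Q ∧ a ∈ τ.positions .output A}

def WellTypedQuery (τ : Typing L) (Q : Query L) : Prop :=
  ∀ (Q₁ : Query L) (l : Literal L ℕ) (Q₂ : Query L), Q = Q₁ ++ l :: Q₂ →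
    JudgementTrue (τ.posOutputs Q₁) (τ.positions .input l.atom)

def WellTypedClause (τ : Typing L) (c : Clause L ℕ) : Prop :=
  (∀ (Q₁ : Query L) (l : Literal L ℕ) (Q₂ : Query L), c.body = Q₁ ++ l :: Q₂ →
    JudgementTrue (τ.positions .input c.head ∪ τ.posOutputs Q₁) (τ.positions .input l.atom)) ∧
  JudgementTrue (τ.positions .input c.head ∪ τ.posOutputs c.body) (τ.positions .output c.head)

def WellTypedProgram (τ : Typing L) (P : Program L) : Prop := ∀ c ∈ P, WellTypedClause τ c

end LogicProg

open LogicProg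

namespace LogicProg

open FirstOrder FirstOrder.Language

/-! ### Substitution, realization and size of terms -/

section Terms

variable {L : FirstOrder.Language.{u, v}}

/-! Finiteness of all derivations is well-foundedness of the step relation (`Terminates`), and it is
compositional: by `Terminates.append`, `Q₁, Q₂` terminates once `Q₁` does and every instance of `Q₂`
by a computed answer of `Q₁` does. Well-typedness passes to resolvents and to these instances
(`ResolvesWith.wellTyped`, `WellTypedQuery.tail_subst`), so single literals suffice, and a negative
literal reduces to its atom.

If the relation of the atom is not defined in `P`, the derivations and their subsidiary trees only
use clauses of `R`, and the hypothesis on `R` applies (`Terminates.union_of_extends`). Otherwise the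
atom is bounded, and one argues by induction on a strict bound `n + 1` for the levels of its ground
instances. Resolution uses a clause of `P`. By acceptability, a literal of the resulting body has
level below `n` in each ground instance that makes the preceding literals true in the model.
Computed answers do make them true, so when a body literal is reached the induction hypothesis
applies to it (`terminates_of_levelsBelow`).

Truth of computed answers (`Answer.sound`) uses the model property for positive literals. For
negative ones it needs soundness of finite failure (`HasOutcome.sound`): an atom over `NegStar` true
in the model would, by the completion, have a resolvent true in it. This rests on unification:
equations solvable in a model of free equality have an mgu through which the solution factors
(`exists_isMGUThrough`). -/

theorem term_subst_subst {α β γ : Type} (t : L.Term α) (f : α → L.Term β) (g : β → L.Term γ) :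
    (t.subst f).subst g = t.subst fun x => (f x).subst g := by
  induction t with
  | var => rfl
  | func f ts ih => simp only [Term.subst, ih]

theorem term_subst_var {α : Type} (t : L.Term α) : t.subst Term.var = t := by
  induction t with
  | var => rfl
  | func f ts ih => simp only [Term.subst, ih]

theorem term_subst_congr {β : Type} (t : L.Term ℕ) (f g : ℕ → L.Term β)
    (h : ∀ x ∈ t.varFinset, f x = g x) : t.subst f = t.subst g := by
  induction t with
  | var x => exact h x (by simp [Term.varFinset])
  | func F ts ih =>
    simp only [Term.subst, Term.func.injEq, heq_eq_eq, true_and]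
    funext i
    exact ih i fun x hx => h x (by simp only [Term.varFinset, Finset.mem_biUnion]; exact ⟨i, Finset.mem_univ _, hx⟩)

theorem term_realize_congr {D : Type w} [L.Structure D] (t : L.Term ℕ) (f g : ℕ → D)
    (h : ∀ x ∈ t.varFinset, f x = g x) : t.realize f = t.realize g := by
  induction t with
  | var x => exact h x (by simp [Term.varFinset])
  | func F ts ih =>
    simp only [Term.realize]
    congr 1
    funext i
    exact ih i fun x hx => h x (by simp only [Term.varFinset, Finset.mem_biUnion]; exact ⟨i, Finset.mem_univ _, hx⟩)

theorem mem_varFinset_subst (t : L.Term ℕ) (f : ℕ → L.Term ℕ) (y : ℕ) :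
    y ∈ (t.subst f).varFinset ↔ ∃ x ∈ t.varFinset, y ∈ (f x).varFinset := by
  induction t with
  | var x => simp [Term.subst, Term.varFinset]
  | func F ts ih =>
    simp only [Term.subst, Term.varFinset, Finset.mem_biUnion, Finset.mem_univ, true_and, ih]
    constructor
    · rintro ⟨i, x, hx, hy⟩; exact ⟨x, ⟨i, hx⟩, hy⟩
    · rintro ⟨x, ⟨i, hx⟩, hy⟩; exact ⟨i, x, hx, hy⟩

/-- The number of symbols of a term. -/
def termSize : L.Term ℕ → ℕ
  | .var _ => 1
  | .func _ ts => 1 + ∑ i, termSize (ts i)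

/-- The total size of a list of equations. -/
def eqnsSize (E : List (L.Term ℕ × L.Term ℕ)) : ℕ :=
  (E.map fun p => termSize p.1 + termSize p.2).sum

theorem termSize_pos (t : L.Term ℕ) : 0 < termSize t := by
  cases t <;> simp only [termSize] <;> omega

/-! ### Unification of equations that are solvable in a model of free equality -/

def Unifies {β : Type} (σ : ℕ → L.Term β) (E : List (L.Term ℕ × L.Term ℕ)) : Prop :=
  ∀ p ∈ E, p.1.subst σ = p.2.subst σ

/-- `σ` is a most general unifier of `E` through which the valuation `s` factors. -/
def IsMGUThrough {D : Type w} [L.Structure D] (σ : ℕ → L.Term ℕ)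
    (E : List (L.Term ℕ × L.Term ℕ)) (s : ℕ → D) : Prop :=
  Unifies σ E ∧
    (∀ τ : ℕ → L.Term ℕ, Unifies τ E → ∃ ρ : ℕ → L.Term ℕ, ∀ x, τ x = (σ x).subst ρ) ∧
    ∃ s' : ℕ → D, ∀ x, s x = (σ x).realize s'

variable {D : Type w} [L.Structure D]

theorem IsMGUThrough.congr {σ : ℕ → L.Term ℕ} {E E' : List (L.Term ℕ × L.Term ℕ)} {s : ℕ → D}
    (h : IsMGUThrough σ E s) (hE : ∀ τ : ℕ → L.Term ℕ, Unifies τ E ↔ Unifies τ E') :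
    IsMGUThrough σ E' s :=
  ⟨(hE σ).1 h.1, fun τ hτ => h.2.1 τ ((hE τ).2 hτ), h.2.2⟩

/-- The substitution binding `x` to `t`. -/
def bind (x : ℕ) (t : L.Term ℕ) : ℕ → L.Term ℕ := Function.update Term.var x t

theorem subst_bind_self {x : ℕ} {t : L.Term ℕ} (hx : x ∉ t.varFinset) : t.subst (bind x t) = t := by
  conv_rhs => rw [← term_subst_var t]
  refine term_subst_congr _ _ _ fun y hy => ?_
  have : y ≠ x := fun h => hx (h ▸ hy)
  simp [bind, this]

theorem bind_subst {β : Type} {x : ℕ} {t : L.Term ℕ} {τ : ℕ → L.Term β} (h : τ x = t.subst τ) (y : ℕ) :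
    (bind x t y).subst τ = τ y := by
  by_cases hy : y = x
  · subst hy; simp [bind, h]
  · simp [bind, hy, Term.subst]

theorem bind_realize {x : ℕ} {t : L.Term ℕ} {s : ℕ → D} (h : s x = t.realize s) (y : ℕ) :
    (bind x t y).realize s = s y := by
  by_cases hy : y = x
  · subst hy; simp [bind, h]
  · simp [bind, hy]

def bindEqns (x : ℕ) (t : L.Term ℕ) (E : List (L.Term ℕ × L.Term ℕ)) :
    List (L.Term ℕ × L.Term ℕ) :=
  E.map fun p => (p.1.subst (bind x t), p.2.subst (bind x t))

theorem unifies_bindEqns {β : Type} (x : ℕ) (t : L.Term ℕ) (E : List (L.Term ℕ × L.Term ℕ))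
    (τ : ℕ → L.Term β) :
    Unifies τ (bindEqns x t E) ↔ Unifies (fun y => (bind x t y).subst τ) E := by
  simp only [Unifies, bindEqns, List.forall_mem_map, term_subst_subst]

/-- A unifier `τ` of `x = t` absorbs the binding: `bind x t` followed by `τ` is `τ`. So it also
unifies the reduced system and factors through its mgu. The valuation `s` absorbs the binding for
the same reason, `s x` being the value of `t`. -/
theorem IsMGUThrough.eliminate {σ : ℕ → L.Term ℕ} {E : List (L.Term ℕ × L.Term ℕ)} {s : ℕ → D}
    {x : ℕ} {t : L.Term ℕ} (hx : x ∉ t.varFinset) (hs : s x = t.realize s)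
    (h : IsMGUThrough σ (bindEqns x t E) s) :
    IsMGUThrough (fun y => (bind x t y).subst σ) ((Term.var x, t) :: E) s := by
  obtain ⟨h1, h2, s', h3⟩ := h
  refine ⟨?_, fun τ hτ => ?_, s', fun y => ?_⟩
  · rw [Unifies, List.forall_mem_cons]
    refine ⟨?_, (unifies_bindEqns _ _ _ _).1 h1⟩
    simp only [Term.subst]
    rw [← term_subst_subst, subst_bind_self hx]
    simp [bind]
  · rw [Unifies, List.forall_mem_cons] at hτ
    obtain ⟨hxt, hτ⟩ := hτ
    have hb := bind_subst (x := x) (t := t) (τ := τ) hxt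
    obtain ⟨ρ, hρ⟩ := h2 τ ((unifies_bindEqns _ _ _ _).2 (by simpa only [hb, Unifies] using hτ))
    refine ⟨ρ, fun y => ?_⟩
    rw [term_subst_subst, ← hb y]
    exact congrArg _ (funext hρ)
  · rw [Term.realize_subst, ← bind_realize hs y]
    exact congrArg (fun v => (bind x t y).realize v) (funext h3)

theorem varFinset_subst_bind_subset {x : ℕ} {t u : L.Term ℕ} {V : Finset ℕ} (hx : x ∉ t.varFinset)
    (ht : t.varFinset ⊆ V) (hu : u.varFinset ⊆ V) :
    (u.subst (bind x t)).varFinset ⊆ V.erase x := by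
  intro y hy
  obtain ⟨z, hz, hy⟩ := (mem_varFinset_subst _ _ _).1 hy
  by_cases hzx : z = x
  · subst hzx
    rw [bind, Function.update_self] at hy
    exact Finset.mem_erase.2 ⟨fun h => hx (h ▸ hy), ht hy⟩
  · rw [bind, Function.update_of_ne hzx] at hy
    simp only [Term.varFinset, Finset.mem_singleton] at hy
    subst hy
    exact Finset.mem_erase.2 ⟨hzx, hu hz⟩

/-- This is the unification algorithm, by lexicographic induction on the number of variables and the
total size. It never fails: `s` solves the equations in `D`, so free equality excludes both a clash
of function symbols and a failed occurs check. -/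
theorem exists_isMGUThrough_aux (hD : FreeEquality L D) (s : ℕ → D) (n : ℕ) :
    ∀ (m : ℕ) (E : List (L.Term ℕ × L.Term ℕ)) (V : Finset ℕ), V.card = n → eqnsSize E = m →
      (∀ p ∈ E, p.1.varFinset ⊆ V ∧ p.2.varFinset ⊆ V) →
      (∀ p ∈ E, p.1.realize s = p.2.realize s) → ∃ σ, IsMGUThrough σ E s := by
  induction n using Nat.strong_induction_on with
  | _ n ihn =>
  intro m
  induction m using Nat.strong_induction_on with
  | _ m ihm =>
  intro E V hV hm hE hs
  -- Substituting for `x` may enlarge the equations, but it removes `x` from `V`, so the outer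
  -- induction applies.
  have elim : ∀ (x : ℕ) (t : L.Term ℕ) (E : List (L.Term ℕ × L.Term ℕ)), x ∉ t.varFinset → x ∈ V →
      t.varFinset ⊆ V → s x = t.realize s →
      (∀ p ∈ E, p.1.varFinset ⊆ V ∧ p.2.varFinset ⊆ V) →
      (∀ p ∈ E, p.1.realize s = p.2.realize s) →
      ∃ σ, IsMGUThrough σ ((Term.var x, t) :: E) s := by
    intro x t E hx hxV ht hst hE hs
    obtain ⟨σ, hσ⟩ := ihn (V.erase x).card (hV ▸ Finset.card_erase_lt_of_mem hxV) _
      (bindEqns x t E) (V.erase x) rfl rfl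
      (by
        simp only [bindEqns, List.forall_mem_map]
        exact fun p hp => ⟨varFinset_subst_bind_subset hx ht (hE p hp).1,
          varFinset_subst_bind_subset hx ht (hE p hp).2⟩)
      (by
        simp only [bindEqns, List.forall_mem_map, Term.realize_subst, bind_realize hst]
        exact hs)
    exact ⟨_, hσ.eliminate hx hst⟩
  cases E with
  | nil =>
    exact ⟨Term.var, by simp [Unifies], fun τ _ => ⟨τ, fun _ => rfl⟩, s, fun _ => rfl⟩
  | cons p E =>
  obtain ⟨t, u⟩ := p
  rw [List.forall_mem_cons] at hE hs
  obtain ⟨⟨ht, hu⟩, hE⟩ := hE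
  obtain ⟨htu, hs⟩ := hs
  simp only at ht hu htu
  have hsize : eqnsSize ((t, u) :: E) = termSize t + termSize u + eqnsSize E := by
    simp [eqnsSize]
  by_cases heq : t = u
  · subst heq
    obtain ⟨σ, hσ⟩ := ihm _ (by have := termSize_pos t; omega) E V hV rfl hE hs
    exact ⟨σ, hσ.congr fun τ => by simp [Unifies]⟩
  cases t with
  | var x =>
    have hx : x ∉ u.varFinset := fun hx => hD.2 x u hx (Ne.symm heq) s htu.symm
    exact elim x u E hx (ht (by simp [Term.varFinset])) hu htu hE hs
  | func f ts =>
    cases u with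
    | var x =>
      have hx : x ∉ (Term.func f ts).varFinset := fun hx => hD.2 x _ hx heq s htu
      obtain ⟨σ, hσ⟩ := elim x _ E hx (hu (by simp [Term.varFinset])) ht htu.symm hE hs
      exact ⟨σ, hσ.congr fun τ => by simp only [Unifies, List.forall_mem_cons, eq_comm]⟩
    | func g us =>
      -- The first equality axiom identifies the function symbols and equates the values of their
      -- arguments.
      have hfg := hD.1 _ _ f g _ _ htu
      rw [Sigma.mk.injEq] at hfg
      obtain ⟨rfl, hfg⟩ := hfg
      rw [heq_eq_eq, Prod.mk.injEq] at hfg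
      obtain ⟨rfl, hargs⟩ := hfg
      have hargs := congrFun hargs
      simp only [Term.varFinset, Finset.biUnion_subset, Finset.mem_univ, forall_const] at ht hu
      obtain ⟨σ, hσ⟩ := ihm (eqnsSize ((List.ofFn fun i => (ts i, us i)) ++ E))
        (by
          rw [← hm, hsize]
          simp only [eqnsSize, List.map_append, List.sum_append, List.map_ofFn, List.sum_ofFn,
            termSize, Function.comp, Finset.sum_add_distrib]
          omega)
        _ V hV rfl
        (by
          simp only [List.mem_append, List.mem_ofFn]
          rintro p (⟨i, rfl⟩ | hp)
          · exact ⟨ht i, hu i⟩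
          · exact hE p hp)
        (by
          simp only [List.mem_append, List.mem_ofFn]
          rintro p (⟨i, rfl⟩ | hp)
          · exact hargs i
          · exact hs p hp)
      refine ⟨σ, hσ.congr fun τ => ?_⟩
      simp only [Unifies, List.forall_mem_append, List.forall_mem_cons, List.forall_mem_ofFn_iff,
        Term.subst, Term.func.injEq, heq_eq_eq, true_and, funext_iff]

theorem exists_isMGUThrough (hD : FreeEquality L D) (s : ℕ → D)
    (E : List (L.Term ℕ × L.Term ℕ)) (hs : ∀ p ∈ E, p.1.realize s = p.2.realize s) :
    ∃ σ, IsMGUThrough σ E s := by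
  classical
  refine exists_isMGUThrough_aux hD s _ _ E
    (E.toFinset.biUnion fun p => p.1.varFinset ∪ p.2.varFinset) rfl rfl (fun p hp => ?_) hs
  constructor
  · exact fun x hx => Finset.mem_biUnion.2 ⟨p, by simpa using hp, Finset.mem_union_left _ hx⟩
  · exact fun x hx => Finset.mem_biUnion.2 ⟨p, by simpa using hp, Finset.mem_union_right _ hx⟩

/-- The factorization of `s` through `σ` is what carries the truth of a clause body over to the
resolvent. -/
theorem exists_isMGU (hD : FreeEquality L D) (s : ℕ → D) (A B : Atom L ℕ)
    (h : (⟨A.arity, A.rel, fun i => (A.args i).realize s⟩ :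
        Σ k, L.Relations k × (Fin k → D)) = ⟨B.arity, B.rel, fun i => (B.args i).realize s⟩) :
    ∃ σ, IsMGU σ A B ∧ ∃ s' : ℕ → D, ∀ x, s x = (σ x).realize s' := by
  obtain ⟨p, a⟩ := A
  obtain ⟨q, b⟩ := B
  rw [Sigma.mk.injEq] at h
  obtain ⟨h1, h⟩ := h
  simp only at h1
  subst h1
  rw [heq_eq_eq, Prod.mk.injEq] at h
  obtain ⟨h1, h⟩ := h
  simp only at h1
  subst h1
  have h := congrFun h
  obtain ⟨σ, h1, h2, h3⟩ := exists_isMGUThrough hD s (List.ofFn fun i => (a i, b i))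
    (by simpa only [List.forall_mem_ofFn_iff] using h)
  simp only [Unifies, List.forall_mem_ofFn_iff] at h1 h2
  refine ⟨σ, ⟨?_, fun τ hτ => h2 τ ?_⟩, h3⟩
  · simp only [Atom.subst, h1]
  · simp only [Atom.subst, Atom.mk.injEq, heq_eq_eq, true_and] at hτ
    exact congrFun hτ

end Terms

variable {L : FirstOrder.Language.{u, v}} {α β γ : Type}

/-! ### Substitution and truth of literals -/

theorem Atom.subst_subst (A : Atom L α) (f : α → L.Term β) (g : β → L.Term γ) :
    (A.subst f).subst g = A.subst fun x => (f x).subst g := by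
  simp only [Atom.subst, term_subst_subst]

theorem Atom.subst_var (A : Atom L α) : A.subst Term.var = A := by
  simp only [Atom.subst, term_subst_var]

theorem Atom.symbol_subst (A : Atom L α) (f : α → L.Term β) : (A.subst f).symbol = A.symbol := rfl

theorem Literal.subst_subst (l : Literal L α) (f : α → L.Term β) (g : β → L.Term γ) :
    (l.subst f).subst g = l.subst fun x => (f x).subst g := by
  cases l <;> simp only [Literal.subst, Atom.subst_subst]

theorem Literal.subst_var (l : Literal L α) : l.subst Term.var = l := by
  cases l <;> simp only [Literal.subst, Atom.subst_var]

theorem Literal.atom_subst (l : Literal L α) (f : α → L.Term β) :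
    (l.subst f).atom = l.atom.subst f := by
  cases l <;> rfl

theorem Literal.symbol_subst (l : Literal L α) (f : α → L.Term β) :
    (l.subst f).atom.symbol = l.atom.symbol := by
  cases l <;> rfl

theorem map_subst_subst (Q : List (Literal L α)) (f : α → L.Term β) (g : β → L.Term γ) :
    (Q.map fun l => l.subst f).map (fun l => l.subst g) =
      Q.map fun l => l.subst fun x => (f x).subst g := by
  simp [Literal.subst_subst]

theorem neg_mem_map_subst {A : Atom L β} {Q : List (Literal L α)} {f : α → L.Term β}
    (h : Literal.neg A ∈ Q.map fun l => l.subst f) :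
    ∃ B, Literal.neg B ∈ Q ∧ A = B.subst f := by
  obtain ⟨l, hl, h⟩ := List.mem_map.1 h
  cases l with
  | pos B => simp [Literal.subst] at h
  | neg B => exact ⟨B, hl, by simpa [Literal.subst] using h.symm⟩

theorem pos_mem_map_subst {A : Atom L β} {Q : List (Literal L α)} {f : α → L.Term β}
    (h : Literal.pos A ∈ Q.map fun l => l.subst f) :
    ∃ B, Literal.pos B ∈ Q ∧ A = B.subst f := by
  obtain ⟨l, hl, h⟩ := List.mem_map.1 h
  cases l with
  | neg B => simp [Literal.subst] at h
  | pos B => exact ⟨B, hl, by simpa [Literal.subst] using h.symm⟩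

section Truth

variable (D : Type w) [L.Structure D]

theorem Atom.holds_subst (A : Atom L α) (f : α → L.Term β) (s : β → D) :
    (A.subst f).Holds D s ↔ A.Holds D fun x => (f x).realize s := by
  simp only [Atom.Holds, Atom.subst, Term.realize_subst]

theorem Literal.holds_subst (l : Literal L α) (f : α → L.Term β) (s : β → D) :
    (l.subst f).Holds D s ↔ l.Holds D fun x => (f x).realize s := by
  cases l <;> simp only [Literal.Holds, Literal.subst, Atom.holds_subst]

theorem Atom.realize_args_congr {A : Atom L ℕ} {s t : ℕ → D} (h : ∀ x ∈ A.vars, s x = t x) :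
    (fun i => (A.args i).realize s) = fun i => (A.args i).realize t :=
  funext fun i => term_realize_congr _ _ _ fun x hx => h x ⟨i, hx⟩

theorem Atom.holds_congr {A : Atom L ℕ} {s t : ℕ → D} (h : ∀ x ∈ A.vars, s x = t x) :
    A.Holds D s ↔ A.Holds D t := by
  simp only [Atom.Holds, Atom.realize_args_congr D h]

theorem Atom.IsGround.holds_iff {A : Atom L ℕ} (h : A.IsGround) (s t : ℕ → D) :
    A.Holds D s ↔ A.Holds D t :=
  Atom.holds_congr D fun x hx => by rw [h] at hx; exact hx.elim

theorem Literal.holds_congr {l : Literal L ℕ} {s t : ℕ → D} (h : ∀ x ∈ l.atom.vars, s x = t x) :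
    l.Holds D s ↔ l.Holds D t := by
  cases l with
  | pos A => exact Atom.holds_congr D h
  | neg A => exact not_congr (Atom.holds_congr D h)

end Truth

/-! ### Variables and renamings -/

theorem Atom.vars_bounded (A : Atom L ℕ) : ∃ N, ∀ x ∈ A.vars, x < N := by
  obtain ⟨N, hN⟩ := (Finset.univ.biUnion fun i => (A.args i).varFinset).bddAbove
  refine ⟨N + 1, fun x hx => ?_⟩
  obtain ⟨i, hi⟩ := hx
  exact Nat.lt_succ_of_le (hN (by simpa using ⟨i, hi⟩))

theorem queryVars_bounded (Q : Query L) : ∃ N, ∀ x ∈ queryVars Q, x < N := by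
  induction Q with
  | nil => exact ⟨0, fun x ⟨l, hl, _⟩ => absurd hl List.not_mem_nil⟩
  | cons l Q ih =>
    obtain ⟨N, hN⟩ := ih
    obtain ⟨M, hM⟩ := l.atom.vars_bounded
    refine ⟨max M N, fun x ⟨k, hk, hx⟩ => ?_⟩
    rcases List.mem_cons.1 hk with rfl | hk
    · exact lt_max_of_lt_left (hM x hx)
    · exact lt_max_of_lt_right (hN x ⟨k, hk, hx⟩)

/-- The permutation of the variables exchanging `x` and `x + N` for `x < N`. -/
def swapBlocks (N : ℕ) : Equiv.Perm ℕ :=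
  Function.Involutive.toPerm (fun x => if x < N then x + N else if x < 2 * N then x - N else x)
    (by intro x; dsimp only; split_ifs <;> omega)

theorem swapBlocks_apply {N x : ℕ} (h : x < N) : swapBlocks N x = x + N := if_pos h

theorem Atom.mem_vars_rename {A : Atom L ℕ} {e : Equiv.Perm ℕ} {x : ℕ}
    (h : x ∈ (A.subst fun y => (Term.var (e y) : L.Term ℕ)).vars) : ∃ y ∈ A.vars, x = e y := by
  obtain ⟨i, hi⟩ := h
  obtain ⟨y, hy, hx⟩ := (mem_varFinset_subst _ _ _).1 hi
  exact ⟨y, ⟨i, hy⟩, by simpa [Term.varFinset] using hx⟩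

theorem Clause.mem_vars_rename {c : Clause L ℕ} {e : Equiv.Perm ℕ} {x : ℕ}
    (h : x ∈ (c.rename e).vars) : ∃ y ∈ c.vars, x = e y := by
  rcases h with h | ⟨l, hl, h⟩
  · obtain ⟨y, hy, h⟩ := Atom.mem_vars_rename h
    exact ⟨y, Or.inl hy, h⟩
  · obtain ⟨k, hk, rfl⟩ := List.mem_map.1 hl
    rw [Literal.atom_subst] at h
    obtain ⟨y, hy, h⟩ := Atom.mem_vars_rename h
    exact ⟨y, Or.inr ⟨k, hk, hy⟩, h⟩

theorem Clause.rename_body_subst (c : Clause L ℕ) (e : Equiv.Perm ℕ) (σ : ℕ → L.Term β) :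
    ((c.rename e).body.map fun l => l.subst σ) = c.body.map fun l => l.subst fun x => σ (e x) := by
  simp only [Clause.rename, Clause.subst, map_subst_subst, Term.subst]

theorem Clause.rename_head_subst (c : Clause L ℕ) (e : Equiv.Perm ℕ) (σ : ℕ → L.Term β) :
    (c.rename e).head.subst σ = c.head.subst fun x => σ (e x) := by
  simp only [Clause.rename, Clause.subst, Atom.subst_subst, Term.subst]

/-! ### Resolvents -/

/-- `Q'` arises from `A, Q` by resolution with the instance `c.subst δ` of a clause of `P`, the
computed substitution being `σ`. -/
structure ResolvesWith (P : Program L) (A : Atom L ℕ) (Q Q' : Query L) (σ : ℕ → L.Term ℕ)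
    (c : Clause L ℕ) (δ : ℕ → L.Term ℕ) : Prop where
  mem : c ∈ P
  head : A.subst σ = c.head.subst δ
  query : Q' = (c.body.map fun l => l.subst δ) ++ Q.map fun l => l.subst σ

theorem Resolvent.exists_resolvesWith {P : Program L} {A : Atom L ℕ} {Q Q' : Query L}
    (h : Resolvent P A Q Q') : ∃ σ c δ, ResolvesWith P A Q Q' σ c δ := by
  obtain ⟨c, hc, e, σ, -, hσ, rfl⟩ := h
  refine ⟨σ, c, fun x => σ (e x), hc, ?_, ?_⟩
  · rw [hσ.1, Clause.rename_head_subst]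
  · rw [List.map_append, Clause.rename_body_subst]

theorem ResolvesWith.symbol_eq {P : Program L} {A : Atom L ℕ} {Q Q' : Query L}
    {σ : ℕ → L.Term ℕ} {c : Clause L ℕ} {δ : ℕ → L.Term ℕ} (h : ResolvesWith P A Q Q' σ c δ) :
    c.head.symbol = A.symbol :=
  (congrArg Atom.symbol h.head).symm

/-- A clause variant with no variable in common with the longer query has none in common with the
shorter one either, so the same variant and mgu serve. -/
theorem Resolvent.append {P : Program L} {A : Atom L ℕ} {Q₁ Q₂ Q' : Query L}
    (h : Resolvent P A (Q₁ ++ Q₂) Q') :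
    ∃ Q₁' σ c δ, Resolvent P A Q₁ Q₁' ∧ ResolvesWith P A Q₁ Q₁' σ c δ ∧
      Q' = Q₁' ++ Q₂.map fun l => l.subst σ := by
  obtain ⟨c, hc, e, σ, hd, hσ, rfl⟩ := h
  refine ⟨_, σ, c, fun x => σ (e x), ⟨c, hc, e, σ, hd.mono_right ?_, hσ, rfl⟩, ⟨hc, ?_, ?_⟩, ?_⟩
  · rintro x ⟨l, hl, hx⟩
    refine ⟨l, ?_, hx⟩
    rw [← List.cons_append]
    exact List.mem_append_left _ hl
  · rw [hσ.1, Clause.rename_head_subst]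
  · rw [List.map_append, Clause.rename_body_subst]
  · simp only [List.map_append, List.append_assoc]

/-! ### Soundness of negation as failure -/

/-- The relations of the negative literals of `Q` belong to `S`. -/
def NegsIn (S : Set (Rel L)) (Q : Query L) : Prop := ∀ A, Literal.neg A ∈ Q → A.symbol ∈ S

/-- The relations of `Q` belong to `S`. -/
def RelsIn (S : Set (Rel L)) (Q : Query L) : Prop := ∀ l ∈ Q, l.atom.symbol ∈ S

theorem NegsIn.append {S : Set (Rel L)} {Q Q' : Query L} (h : NegsIn S Q) (h' : NegsIn S Q') :
    NegsIn S (Q ++ Q') :=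
  fun A hA => (List.mem_append.1 hA).elim (h A) (h' A)

theorem NegsIn.subst {S : Set (Rel L)} {Q : Query L} (h : NegsIn S Q) (σ : ℕ → L.Term ℕ) :
    NegsIn S (Q.map fun l => l.subst σ) := by
  intro A hA
  obtain ⟨B, hB, rfl⟩ := neg_mem_map_subst hA
  exact h B hB

theorem NegsIn.tail {S : Set (Rel L)} {Q : Query L} {l : Literal L ℕ} (h : NegsIn S (l :: Q)) :
    NegsIn S Q :=
  fun A hA => h A (List.mem_cons_of_mem _ hA)

theorem RelsIn.append {S : Set (Rel L)} {Q Q' : Query L} (h : RelsIn S Q) (h' : RelsIn S Q') :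
    RelsIn S (Q ++ Q') :=
  fun A hA => (List.mem_append.1 hA).elim (h A) (h' A)

theorem RelsIn.subst {S : Set (Rel L)} {Q : Query L} (h : RelsIn S Q) (σ : ℕ → L.Term ℕ) :
    RelsIn S (Q.map fun l => l.subst σ) := by
  intro l hl
  obtain ⟨k, hk, rfl⟩ := List.mem_map.1 hl
  rw [Literal.symbol_subst]
  exact h k hk

theorem RelsIn.tail {S : Set (Rel L)} {Q : Query L} {l : Literal L ℕ} (h : RelsIn S (l :: Q)) :
    RelsIn S Q :=
  fun k hk => h k (List.mem_cons_of_mem _ hk)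

theorem relsIn_singleton {S : Set (Rel L)} {l : Literal L ℕ} :
    RelsIn S [l] ↔ l.atom.symbol ∈ S := by
  simp [RelsIn]

theorem negsIn_body {P : Program L} {c : Clause L ℕ} (hc : c ∈ P) : NegsIn (NegStar P) c.body :=
  fun A hA => ⟨A.symbol, ⟨c, hc, A, hA, rfl⟩, Relation.ReflTransGen.refl⟩

theorem relsIn_body {P : Program L} {c : Clause L ℕ} (hc : c ∈ P)
    (h : c.head.symbol ∈ NegStar P) : RelsIn (NegStar P) c.body := by
  obtain ⟨p, hp, hpc⟩ := h
  exact fun l hl => ⟨p, hp, hpc.tail ⟨c, hc, rfl, l, hl, rfl⟩⟩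

section Soundness

variable {D : Type w} [L.Structure D] {P : Program L}

theorem ResolvesWith.head_holds (hM : IsModel D P) {A : Atom L ℕ} {Q Q' : Query L}
    {σ : ℕ → L.Term ℕ} {c : Clause L ℕ} {δ : ℕ → L.Term ℕ} (h : ResolvesWith P A Q Q' σ c δ)
    {s : ℕ → D} (hs : ∀ l ∈ Q', l.Holds D s) : (A.subst σ).Holds D s := by
  rw [h.head, Atom.holds_subst]
  refine hM c h.mem _ fun l hl => ?_
  rw [← Literal.holds_subst]
  refine hs _ ?_
  rw [h.query]
  exact List.mem_append_left _ (List.mem_map_of_mem hl)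

/-- A query true in a complete model, with all its relations in `NegStar P`, has a resolvent that
is true in the model. -/
theorem exists_resolvent_holds (hM : IsCompleteModel D P) {A : Atom L ℕ} {Q : Query L} {s : ℕ → D}
    (hA : A.symbol ∈ NegStar P) (hQ : RelsIn (NegStar P) Q) (hAs : A.Holds D s)
    (hQs : ∀ l ∈ Q, l.Holds D s) :
    ∃ Q' s', Resolvent P A Q Q' ∧ RelsIn (NegStar P) Q' ∧ ∀ l ∈ Q', l.Holds D s' := by
  obtain ⟨c, hc, t, hct, hbody⟩ := (hM.2.2 A.arity A.rel hA _).1 hAs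
  obtain ⟨N₁, hN₁⟩ := queryVars_bounded (.pos A :: Q)
  obtain ⟨N₂, hN₂⟩ := queryVars_bounded (.pos c.head :: c.body)
  set N := max N₁ N₂
  have hcN : ∀ x ∈ c.vars, x < N := fun x hx => lt_max_of_lt_right <| hN₂ x <| by
    rcases hx with hx | ⟨l, hl, hx⟩
    · exact ⟨_, List.mem_cons_self, hx⟩
    · exact ⟨l, List.mem_cons_of_mem _ hl, hx⟩
  have hQN : ∀ x ∈ queryVars (.pos A :: Q), x < N := fun x hx => lt_max_of_lt_left (hN₁ x hx)
  let e := swapBlocks N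
  -- The clause variables are shifted by `N`, so one valuation acts as `s` on the query and as `t`
  -- on the renamed clause, and it makes the two atoms equal in `D`.
  let r : ℕ → D := fun x => if x < N then s x else t (x - N)
  have hrs : ∀ x < N, r x = s x := fun x hx => if_pos hx
  have hrt : ∀ x ∈ c.vars, r (e x) = t x := fun x hx => by
    have : e x = x + N := swapBlocks_apply (hcN x hx)
    simp [r, this]
  obtain ⟨σ, hσ, s', hs'⟩ := exists_isMGU (hM.2.1 ⟨c, hc⟩) r A (c.rename e).head (by
    have h1 : (fun i => (A.args i).realize r) = fun i => (A.args i).realize s :=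
      Atom.realize_args_congr D fun x hx => hrs x (hQN x ⟨_, List.mem_cons_self, hx⟩)
    have h2 : (fun i => ((c.rename e).head.args i).realize r) =
        fun i => (c.head.args i).realize t := by
      simp only [Clause.rename, Clause.subst, Atom.subst, Term.realize_subst, Term.realize_var]
      exact Atom.realize_args_congr D fun x hx => hrt x (Or.inl hx)
    rw [h1, h2]
    exact hct.symm)
  refine ⟨((c.rename e).body ++ Q).map fun l => l.subst σ, s', ⟨c, hc.1, e, σ, ?_, hσ, rfl⟩, ?_, ?_⟩
  · rw [Set.disjoint_left]
    intro x hx hxQ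
    obtain ⟨y, hy, rfl⟩ := Clause.mem_vars_rename hx
    have h1 : e y = y + N := swapBlocks_apply (hcN y hy)
    have h2 := hQN _ hxQ
    omega
  · refine RelsIn.subst (RelsIn.append ?_ hQ) σ
    exact (relsIn_body hc.1 hc.2).subst _
  · simp only [List.forall_mem_map, Literal.holds_subst, ← hs', List.forall_mem_append]
    refine ⟨?_, fun l hl => ?_⟩
    · simp only [Clause.rename, Clause.subst, List.forall_mem_map, Literal.holds_subst,
        Term.realize_var]
      exact fun l hl => (Literal.holds_congr D fun x hx => hrt x (Or.inr ⟨l, hl, hx⟩)).2 (hbody l hl)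
    · exact (Literal.holds_congr D fun x hx =>
        hrs x (hQN x ⟨l, List.mem_cons_of_mem _ hl, hx⟩)).2 (hQs l hl)

/-- Soundness of LDNF-trees with respect to complete models. -/
theorem HasOutcome.sound [Nonempty D] (hM : IsCompleteModel D P) {o : Outcome} {Q : Query L}
    (h : HasOutcome P o Q) :
    match o with
    | .success => NegsIn (NegStar P) Q → ∃ s : ℕ → D, ∀ l ∈ Q, l.Holds D s
    | .failure => RelsIn (NegStar P) Q → ∀ s : ℕ → D, ¬ ∀ l ∈ Q, l.Holds D s := by
  -- The two outcomes call each other through negative literals. Success only uses that the clauses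
  -- are true, so only negative literals must lie in `NegStar P`; failure uses the completion, so
  -- all relations must.
  induction h with
  | success_nil => exact fun _ => ⟨fun _ => Classical.arbitrary D, by simp⟩
  | success_pos hr _ ih =>
    intro hN
    obtain ⟨σ, c, δ, hr⟩ := hr.exists_resolvesWith
    obtain ⟨s, hs⟩ := ih (by
      rw [hr.query]
      exact ((negsIn_body hr.mem).subst _).append (hN.tail.subst _))
    refine ⟨fun x => (σ x).realize s, List.forall_mem_cons.2 ⟨?_, fun l hl => ?_⟩⟩
    · exact (Atom.holds_subst D _ _ _).1 (hr.head_holds hM.1 hs)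
    · rw [← Literal.holds_subst]
      refine hs _ ?_
      rw [hr.query]
      exact List.mem_append_right _ (List.mem_map_of_mem hl)
  | success_neg hg _ _ ih₁ ih₂ =>
    intro hN
    obtain ⟨s, hs⟩ := ih₂ hN.tail
    refine ⟨s, List.forall_mem_cons.2 ⟨fun hA => ?_, hs⟩⟩
    exact ih₁ (relsIn_singleton.2 (hN _ List.mem_cons_self)) s (by simpa [Literal.Holds] using hA)
  | failure_pos _ ih =>
    intro hR s hs
    rw [List.forall_mem_cons] at hs
    obtain ⟨Q', s', hr, hR', hs'⟩ := exists_resolvent_holds hM (hR _ List.mem_cons_self)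
      hR.tail hs.1 hs.2
    exact ih Q' hr hR' s' hs'
  | failure_neg hg _ ih =>
    intro _ s hs
    -- The query `A` has no negative literal, so the condition is vacuous; groundness then makes `t`
    -- irrelevant.
    obtain ⟨t, ht⟩ := ih (by simp [NegsIn])
    exact hs _ List.mem_cons_self ((hg.holds_iff D t s).1 (ht _ List.mem_cons_self))
  | failure_neg_next _ _ _ _ ih =>
    exact fun hR s hs => ih hR.tail s fun l hl => hs l (List.mem_cons_of_mem _ hl)

theorem not_holds_of_failure [Nonempty D] (hM : IsCompleteModel D P) {A : Atom L ℕ}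
    (hA : A.symbol ∈ NegStar P) (h : HasOutcome P .failure [.pos A]) (s : ℕ → D) :
    ¬ A.Holds D s := fun hs =>
  h.sound hM (relsIn_singleton.2 hA) s (by simpa [Literal.Holds] using hs)

end Soundness

variable {L : FirstOrder.Language.{u, v}}

/-! ### Well-typed queries -/

/-- The terms in the positions of `A` of mode `m` belong to the types of these positions. -/
def TypedAt (τ : Typing L) (m : Mode) (A : Atom L ℕ) : Prop :=
  ∀ i, τ.mode A.rel i = m → A.args i ∈ (τ.type A.rel i).carrier

/-- The outputs of the positive literals of the instance of `Q` by `θ` are correctly typed. -/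
def OutputsTyped (τ : Typing L) (Q : Query L) (θ : ℕ → L.Term ℕ) : Prop :=
  ∀ A, Literal.pos A ∈ Q → TypedAt τ .output (A.subst θ)

/-- Well-typedness of a query relative to a condition on substitutions. -/
def WellTypedFrom (τ : Typing L) : ((ℕ → L.Term ℕ) → Prop) → Query L → Prop
  | _, [] => True
  | H, l :: Q => (∀ θ, H θ → TypedAt τ .input (l.atom.subst θ)) ∧
      WellTypedFrom τ (fun θ => H θ ∧ OutputsTyped τ [l] θ) Q

variable {τ : Typing L}

theorem typedAt_subst_iff {m : Mode} {A : Atom L ℕ} {θ : ℕ → L.Term ℕ} :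
    (∀ a ∈ τ.positions m A, a.1.subst θ ∈ a.2.carrier) ↔ TypedAt τ m (A.subst θ) := by
  constructor
  · exact fun h i hi => h _ ⟨i, hi, rfl⟩
  · rintro h _ ⟨i, hi, rfl⟩
    exact h i hi

theorem outputsTyped_iff {Q : Query L} {θ : ℕ → L.Term ℕ} :
    (∀ a ∈ τ.posOutputs Q, a.1.subst θ ∈ a.2.carrier) ↔ OutputsTyped τ Q θ := by
  constructor
  · exact fun h A hA => typedAt_subst_iff.1 fun a ha => h a ⟨A, hA, ha⟩
  · rintro h a ⟨A, hA, ha⟩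
    exact typedAt_subst_iff.2 (h A hA) a ha

theorem outputsTyped_append {Q Q' : Query L} {θ : ℕ → L.Term ℕ} :
    OutputsTyped τ (Q ++ Q') θ ↔ OutputsTyped τ Q θ ∧ OutputsTyped τ Q' θ := by
  simp only [OutputsTyped, List.mem_append, or_imp, forall_and]

theorem outputsTyped_cons {l : Literal L ℕ} {Q : Query L} {θ : ℕ → L.Term ℕ} :
    OutputsTyped τ (l :: Q) θ ↔ OutputsTyped τ [l] θ ∧ OutputsTyped τ Q θ :=
  outputsTyped_append (Q := [l])

theorem outputsTyped_nil {θ : ℕ → L.Term ℕ} : OutputsTyped τ [] θ :=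
  fun _ h => absurd h List.not_mem_nil

theorem outputsTyped_pos {A : Atom L ℕ} {θ : ℕ → L.Term ℕ} :
    OutputsTyped τ [.pos A] θ ↔ TypedAt τ .output (A.subst θ) := by
  simp [OutputsTyped]

theorem outputsTyped_neg {A : Atom L ℕ} {θ : ℕ → L.Term ℕ} : OutputsTyped τ [.neg A] θ := by
  simp [OutputsTyped]

theorem outputsTyped_subst {Q : Query L} {σ θ : ℕ → L.Term ℕ} :
    OutputsTyped τ (Q.map fun l => l.subst σ) θ ↔
      OutputsTyped τ Q fun x => (σ x).subst θ := by
  constructor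
  · intro h A hA
    rw [← Atom.subst_subst]
    exact h _ (List.mem_map_of_mem (f := fun l : Literal L ℕ => l.subst σ) hA)
  · intro h A hA
    obtain ⟨B, hB, rfl⟩ := pos_mem_map_subst hA
    rw [Atom.subst_subst]
    exact h B hB

/-- The recursive form accumulates in `H` the typing of the outputs already passed, which suits
induction along the query. -/
theorem wellTypedFrom_iff {H : (ℕ → L.Term ℕ) → Prop} {Q : Query L} :
    WellTypedFrom τ H Q ↔ ∀ (Q₁ : Query L) (l : Literal L ℕ) (Q₂ : Query L), Q = Q₁ ++ l :: Q₂ →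
      ∀ θ, H θ → OutputsTyped τ Q₁ θ → TypedAt τ .input (l.atom.subst θ) := by
  induction Q generalizing H with
  | nil => simp [WellTypedFrom]
  | cons k Q ih =>
    rw [WellTypedFrom, ih]
    constructor
    · rintro ⟨h1, h2⟩ Q₁ l Q₂ hQ θ hH hO
      cases Q₁ with
      | nil =>
        obtain ⟨rfl, -⟩ := List.cons.inj hQ
        exact h1 θ hH
      | cons k' Q₁ =>
        obtain ⟨rfl, hQ'⟩ := List.cons.inj hQ
        rw [outputsTyped_cons] at hO
        exact h2 Q₁ l Q₂ hQ' θ ⟨hH, hO.1⟩ hO.2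
    · intro h
      refine ⟨fun θ hH => h [] k Q rfl θ hH outputsTyped_nil, ?_⟩
      rintro Q₁ l Q₂ rfl θ hH hO
      exact h (k :: Q₁) l Q₂ rfl θ hH.1 (outputsTyped_cons.2 ⟨hH.2, hO⟩)

theorem WellTypedFrom.mono {H H' : (ℕ → L.Term ℕ) → Prop} {Q : Query L}
    (h : WellTypedFrom τ H Q) (hH : ∀ θ, H' θ → H θ) : WellTypedFrom τ H' Q :=
  wellTypedFrom_iff.2 fun Q₁ l Q₂ hQ θ hθ => wellTypedFrom_iff.1 h Q₁ l Q₂ hQ θ (hH θ hθ)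

theorem WellTypedFrom.append {H : (ℕ → L.Term ℕ) → Prop} {Q Q' : Query L}
    (h : WellTypedFrom τ H Q) (h' : WellTypedFrom τ (fun θ => H θ ∧ OutputsTyped τ Q θ) Q') :
    WellTypedFrom τ H (Q ++ Q') := by
  induction Q generalizing H with
  | nil => exact h'.mono fun θ hθ => ⟨hθ, outputsTyped_nil⟩
  | cons l Q ih =>
    refine ⟨h.1, ih h.2 (h'.mono fun θ hθ => ?_)⟩
    exact ⟨hθ.1.1, outputsTyped_cons.2 ⟨hθ.1.2, hθ.2⟩⟩

theorem WellTypedFrom.subst {H H' : (ℕ → L.Term ℕ) → Prop} {Q : Query L}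
    (h : WellTypedFrom τ H Q) {σ : ℕ → L.Term ℕ} (hH : ∀ θ, H' θ → H fun x => (σ x).subst θ) :
    WellTypedFrom τ H' (Q.map fun l => l.subst σ) := by
  induction Q generalizing H H' with
  | nil => trivial
  | cons l Q ih =>
    refine ⟨fun θ hθ => ?_, ih h.2 fun θ hθ => ⟨hH θ hθ.1, ?_⟩⟩
    · rw [Literal.atom_subst, Atom.subst_subst]
      exact h.1 _ (hH θ hθ)
    · exact outputsTyped_subst (Q := [l]).1 hθ.2

theorem wellTypedQuery_iff {Q : Query L} :
    WellTypedQuery τ Q ↔ WellTypedFrom τ (fun _ => True) Q := by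
  simp only [WellTypedQuery, wellTypedFrom_iff, JudgementTrue, outputsTyped_iff, typedAt_subst_iff,
    forall_const]

theorem wellTypedClause_iff {c : Clause L ℕ} :
    WellTypedClause τ c ↔
      WellTypedFrom τ (fun θ => TypedAt τ .input (c.head.subst θ)) c.body ∧
      ∀ θ, TypedAt τ .input (c.head.subst θ) → OutputsTyped τ c.body θ →
        TypedAt τ .output (c.head.subst θ) := by
  simp only [WellTypedClause, wellTypedFrom_iff, JudgementTrue, Set.mem_union, or_imp, forall_and,
    outputsTyped_iff, typedAt_subst_iff, and_imp]

theorem wellTypedQuery_singleton {l : Literal L ℕ} :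
    WellTypedQuery τ [l] ↔ ∀ θ : ℕ → L.Term ℕ, TypedAt τ .input (l.atom.subst θ) := by
  simp [wellTypedQuery_iff, WellTypedFrom]

theorem WellTypedQuery.head {l : Literal L ℕ} {Q : Query L} (h : WellTypedQuery τ (l :: Q))
    (θ : ℕ → L.Term ℕ) : TypedAt τ .input (l.atom.subst θ) :=
  (wellTypedQuery_iff.1 h).1 θ trivial

section Resolution

variable {P : Program L} {A : Atom L ℕ} {Q Q' : Query L} {σ δ : ℕ → L.Term ℕ} {c : Clause L ℕ}

theorem ResolvesWith.typedAt_iff (h : ResolvesWith P A Q Q' σ c δ) {m : Mode} {θ : ℕ → L.Term ℕ} :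
    TypedAt τ m (c.head.subst fun x => (δ x).subst θ) ↔
      TypedAt τ m (A.subst fun x => (σ x).subst θ) := by
  rw [← Atom.subst_subst, ← Atom.subst_subst, h.head]

/-- The instances of `A` and of the clause head coincide. The inputs are typed because the query is,
and the clause passes typing from the body outputs to the head outputs. -/
theorem ResolvesWith.output_typed (hP : WellTypedProgram τ P) (h : ResolvesWith P A Q Q' σ c δ)
    (hA : ∀ θ : ℕ → L.Term ℕ, TypedAt τ .input (A.subst θ)) {θ : ℕ → L.Term ℕ}
    (ho : OutputsTyped τ (c.body.map fun l => l.subst δ) θ) :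
    TypedAt τ .output (A.subst fun x => (σ x).subst θ) :=
  h.typedAt_iff.1 ((wellTypedClause_iff.1 (hP c h.mem)).2 _ (h.typedAt_iff.2 (hA _))
    (outputsTyped_subst.1 ho))

/-- Well-typedness is persistent under resolution. -/
theorem ResolvesWith.wellTyped (hP : WellTypedProgram τ P) (h : ResolvesWith P A Q Q' σ c δ)
    (hQ : WellTypedQuery τ (.pos A :: Q)) : WellTypedQuery τ Q' := by
  have hA := hQ.head
  rw [h.query, wellTypedQuery_iff]
  refine WellTypedFrom.append ?_ ?_
  · exact (wellTypedClause_iff.1 (hP c h.mem)).1.subst fun θ _ => h.typedAt_iff.2 (hA _)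
  · exact (wellTypedQuery_iff.1 hQ).2.subst fun θ hθ =>
      ⟨trivial, outputsTyped_pos.2 (h.output_typed hP hA hθ.2)⟩

end Resolution

/-! ### Computed answers -/

/-- `θ` is the composition of the substitutions computed along a successful derivation of `Q`. -/
inductive Answer (P : Program L) : Query L → (ℕ → L.Term ℕ) → Prop where
  | nil : Answer P [] Term.var
  | pos {A : Atom L ℕ} {Q Q' : Query L} {σ δ θ : ℕ → L.Term ℕ} {c : Clause L ℕ} :
      ResolvesWith P A Q Q' σ c δ → Answer P Q' θ →
        Answer P (.pos A :: Q) fun x => (σ x).subst θ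
  | neg {A : Atom L ℕ} {Q : Query L} {θ : ℕ → L.Term ℕ} :
      A.IsGround → HasOutcome P .failure [.pos A] → Answer P Q θ → Answer P (.neg A :: Q) θ

section Answers

variable {P : Program L} {Q : Query L} {θ : ℕ → L.Term ℕ}

/-- The induction goes back from the empty query: typed outputs of a resolvent include those of the
clause body, hence give those of the selected atom. -/
theorem Answer.outputsTyped (hP : WellTypedProgram τ P) (h : Answer P Q θ)
    (hQ : WellTypedQuery τ Q) (η : ℕ → L.Term ℕ) :
    OutputsTyped τ Q fun x => (θ x).subst η := by
  induction h with
  | nil => exact outputsTyped_nil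
  | pos hr _ ih =>
    have ih := ih (hr.wellTyped hP hQ)
    rw [hr.query, outputsTyped_append] at ih
    simp only [term_subst_subst]
    refine outputsTyped_cons.2 ⟨outputsTyped_pos.2 (hr.output_typed hP hQ.head ih.1), ?_⟩
    exact outputsTyped_subst.1 ih.2
  | neg _ _ _ ih =>
    refine outputsTyped_cons.2 ⟨outputsTyped_neg, ih ?_⟩
    rw [wellTypedQuery_iff] at hQ ⊢
    exact hQ.2.mono fun _ _ => ⟨trivial, outputsTyped_neg⟩

theorem WellTypedQuery.tail_subst (hP : WellTypedProgram τ P) {l : Literal L ℕ}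
    (hQ : WellTypedQuery τ (l :: Q)) (h : Answer P [l] θ) :
    WellTypedQuery τ (Q.map fun l => l.subst θ) := by
  rw [wellTypedQuery_iff]
  exact (wellTypedQuery_iff.1 hQ).2.subst fun η _ =>
    ⟨trivial, h.outputsTyped hP (wellTypedQuery_singleton.2 hQ.head) η⟩

theorem Answer.sound {D : Type w} [L.Structure D] [Nonempty D] (hM : IsCompleteModel D P)
    (h : Answer P Q θ) (hQ : NegsIn (NegStar P) Q) (s : ℕ → D) :
    ∀ l ∈ Q, l.Holds D fun x => (θ x).realize s := by
  induction h with
  | nil => simp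
  | @pos A Q Q' σ δ θ c hr _ ih =>
    have ih := ih (by
      rw [hr.query]
      exact ((negsIn_body hr.mem).subst _).append (hQ.tail.subst _))
    simp only [Term.realize_subst]
    refine List.forall_mem_cons.2 ⟨?_, fun l hl => ?_⟩
    · rw [Literal.Holds, ← Atom.holds_subst]
      refine hr.head_holds hM.1 (s := fun x => (θ x).realize s) ih
    · rw [← Literal.holds_subst]
      refine ih _ ?_
      rw [hr.query]
      exact List.mem_append_right _ (List.mem_map_of_mem hl)
  | neg hg hf _ ih =>
    exact List.forall_mem_cons.2
      ⟨not_holds_of_failure hM (hQ _ List.mem_cons_self) hf _, ih hQ.tail⟩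

end Answers

/-! ### Termination -/

/-- The query `Q` is accessible for the inverse of the step relation. -/
def Terminates (P : Program L) (Q : Query L) : Prop := Acc (fun Q₁ Q₂ => Step P Q₂ Q₁) Q

theorem allDerivationsFinite_iff {P : Program L} {Q : Query L} :
    AllDerivationsFinite P Q ↔ Terminates P Q := by
  rw [AllDerivationsFinite, Terminates, ← not_iff_not, not_not, not_acc_iff_exists_descending_chain]

theorem terminates_nil {P : Program L} : Terminates P [] :=
  Acc.intro _ fun _ h => nomatch h

/-- A query terminates if its first part does and all instances of the second part by answers of
the first part do. -/
theorem Terminates.append {P : Program L} {Q₁ Q₂ : Query L} (h : Terminates P Q₁)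
    (h₂ : ∀ θ, Answer P Q₁ θ → Terminates P (Q₂.map fun l => l.subst θ)) :
    Terminates P (Q₁ ++ Q₂) := by
  induction h generalizing Q₂ with
  | intro Q₁ hacc ih =>
  cases Q₁ with
  | nil => simpa [Literal.subst_var] using h₂ _ Answer.nil
  | cons l Q₁ =>
    refine Acc.intro _ fun Q' hs => ?_
    cases hs with
    | resolve hr =>
      -- The step takes place in `Q₁` and merely instantiates `Q₂` by `σ`; an answer of `Q₁'`
      -- preceded by `σ` is an answer of `l :: Q₁`.
      obtain ⟨Q₁', σ, c, δ, hr', hrw, rfl⟩ := hr.append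
      refine ih Q₁' (.resolve hr') fun θ hθ => ?_
      rw [map_subst_subst]
      exact h₂ _ (.pos hrw hθ)
    -- The subsidiary tree depends on the first literal only, so `Q₂` plays no role.
    | subsidiary hg => exact hacc _ (.subsidiary hg)
    | next hg hf => exact ih Q₁ (.next hg hf) fun θ hθ => h₂ θ (.neg hg hf hθ)

theorem Terminates.neg {P : Program L} {A : Atom L ℕ} (h : Terminates P [.pos A]) :
    Terminates P [.neg A] := by
  refine Acc.intro _ fun Q' hs => ?_
  cases hs with
  | subsidiary _ => exact h
  | next _ _ => exact terminates_nil

theorem Terminates.of_atom {P : Program L} {l : Literal L ℕ} (h : Terminates P [.pos l.atom]) :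
    Terminates P [l] := by
  cases l with
  | pos A => exact h
  | neg A => exact h.neg

/-! ### Queries not concerned by an extension -/

section Extension

variable {P R : Program L}

/-- A clause of `P` would define the relation of `A`, so the clause is in `R`, and its body mentions
no relation defined in `P`. -/
theorem Resolvent.of_union (hPR : Extends P R) {A : Atom L ℕ} {Q Q' : Query L}
    (h : Resolvent (P ∪ R) A Q Q') (hQ : RelsIn {p | ¬ DefinedIn P p} (.pos A :: Q)) :
    Resolvent R A Q Q' ∧ RelsIn {p | ¬ DefinedIn P p} Q' := by
  obtain ⟨c, hc, e, σ, hd, hσ, rfl⟩ := h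
  have hcA : c.head.symbol = A.symbol := (congrArg Atom.symbol hσ.1).symm
  have hcR : c ∈ R := hc.resolve_left fun h => hQ _ List.mem_cons_self ⟨c, h, hcA⟩
  refine ⟨⟨c, hcR, e, σ, hd, hσ, rfl⟩, (RelsIn.append (RelsIn.subst ?_ _) hQ.tail).subst σ⟩
  exact fun l hl hl' => hPR _ hl' ⟨c, hcR, Or.inr ⟨l, hl, rfl⟩⟩

theorem Resolvent.mono {A : Atom L ℕ} {Q Q' : Query L} (h : Resolvent R A Q Q') :
    Resolvent (P ∪ R) A Q Q' := by
  obtain ⟨c, hc, h⟩ := h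
  exact ⟨c, Or.inr hc, h⟩

/-- Passing a negative literal depends on a finite failure, so outcomes must be transferred to `R`
along with steps. -/
theorem HasOutcome.of_union (hPR : Extends P R) {o : Outcome} {Q : Query L}
    (h : HasOutcome (P ∪ R) o Q) (hQ : RelsIn {p | ¬ DefinedIn P p} Q) : HasOutcome R o Q := by
  have single : ∀ {A : Atom L ℕ} {Q : Query L}, RelsIn {p | ¬ DefinedIn P p} (.neg A :: Q) →
      RelsIn {p | ¬ DefinedIn P p} [.pos A] :=
    fun h => relsIn_singleton.2 (h (.neg _) List.mem_cons_self)
  induction h with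
  | success_nil => exact .success_nil
  | success_pos hr _ ih =>
    obtain ⟨hr, hQ'⟩ := hr.of_union hPR hQ
    exact .success_pos hr (ih hQ')
  | success_neg hg _ _ ih₁ ih₂ => exact .success_neg hg (ih₁ (single hQ)) (ih₂ hQ.tail)
  | failure_pos _ ih =>
    exact .failure_pos fun Q' hr => ih Q' hr.mono (hr.mono.of_union hPR hQ).2
  | failure_neg hg _ ih => exact .failure_neg hg (ih (single hQ))
  | failure_neg_next hg _ _ ih₁ ih₂ => exact .failure_neg_next hg (ih₁ (single hQ)) (ih₂ hQ.tail)

theorem Step.of_union (hPR : Extends P R) {Q Q' : Query L} (h : Step (P ∪ R) Q Q')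
    (hQ : RelsIn {p | ¬ DefinedIn P p} Q) : Step R Q Q' ∧ RelsIn {p | ¬ DefinedIn P p} Q' := by
  cases h with
  | resolve hr =>
    obtain ⟨hr, hQ'⟩ := hr.of_union hPR hQ
    exact ⟨.resolve hr, hQ'⟩
  | subsidiary hg => exact ⟨.subsidiary hg, relsIn_singleton.2 (hQ (.neg _) List.mem_cons_self)⟩
  | next hg hf =>
    exact ⟨.next hg (hf.of_union hPR (relsIn_singleton.2 (hQ (.neg _) List.mem_cons_self))), hQ.tail⟩

theorem Terminates.union_of_extends (hPR : Extends P R) {Q : Query L} (h : Terminates R Q)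
    (hQ : RelsIn {p | ¬ DefinedIn P p} Q) : Terminates (P ∪ R) Q := by
  induction h with
  | intro Q _ ih =>
  refine Acc.intro _ fun Q' hs => ?_
  obtain ⟨hs, hQ'⟩ := hs.of_union hPR hQ
  exact ih Q' hs hQ'

end Extension

/-! ### Acceptability -/

/-- In every ground instance of `Q`, the level of each literal preceded by true literals only is
smaller than `n`. -/
def LevelsBelow (D : Type w) [L.Structure D] (level : LevelMapping L) (n : ℕ) (Q : Query L) :
    Prop :=
  ∀ (Q₁ : Query L) (l : Literal L ℕ) (Q₂ : Query L), Q = Q₁ ++ l :: Q₂ →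
    ∀ γ : ℕ → L.Term Empty, (∀ k ∈ Q₁, (k.subst γ).Holds D fun x : Empty => x.elim) →
      level (l.atom.subst γ) < n

section Acceptability

variable {D : Type w} [L.Structure D] {level : LevelMapping L} {n : ℕ}

theorem LevelsBelow.head {l : Literal L ℕ} {Q : Query L} (h : LevelsBelow D level n (l :: Q))
    (γ : ℕ → L.Term Empty) : level (l.atom.subst γ) < n :=
  h [] l Q rfl γ (by simp)

/-- Since `l` under `θ` is true everywhere, it can be put back in front of any true prefix of the
instantiated tail. -/
theorem LevelsBelow.tail_subst {l : Literal L ℕ} {Q : Query L} {θ : ℕ → L.Term ℕ}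
    (h : LevelsBelow D level n (l :: Q)) (hl : ∀ s : ℕ → D, (l.subst θ).Holds D s) :
    LevelsBelow D level n (Q.map fun l => l.subst θ) := by
  intro Q₁ k Q₂ hQ γ hγ
  obtain ⟨Q₁', Q₂', rfl, rfl, hQ₂⟩ := List.map_eq_append_iff.1 hQ
  obtain ⟨k', Q₂'', rfl, rfl, rfl⟩ := List.map_eq_cons_iff.1 hQ₂
  rw [Literal.atom_subst, Atom.subst_subst]
  refine h (l :: Q₁') k' Q₂'' rfl _ (List.forall_mem_cons.2 ⟨?_, fun m hm => ?_⟩)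
  · rw [← Literal.subst_subst, Literal.holds_subst]
    exact hl _
  · rw [← Literal.subst_subst]
    exact hγ _ (List.mem_map_of_mem hm)

theorem Acceptable.levelsBelow {P : Program L} (hP : Acceptable D P level) {c : Clause L ℕ}
    (hc : c ∈ P) {δ : ℕ → L.Term ℕ}
    (hn : ∀ γ : ℕ → L.Term Empty, level ((c.head.subst δ).subst γ) ≤ n) :
    LevelsBelow D level n (c.body.map fun l => l.subst δ) := by
  intro Q₁ l Q₂ hQ γ hγ
  refine lt_of_lt_of_le ?_ (hn γ)
  rw [← Literal.atom_subst, Atom.subst_subst]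
  refine hP c hc (fun x => (δ x).subst γ) (Q₁.map fun k => k.subst γ) (l.subst γ)
    (Q₂.map fun k => k.subst γ) ?_ (by simpa only [List.forall_mem_map] using hγ)
  have := congrArg (List.map fun k : Literal L ℕ => k.subst γ) hQ
  rw [map_subst_subst] at this
  simpa [Clause.subst] using this

end Acceptability

/-! ### Termination of well-typed queries -/

/-- Induction is on the length because the tail is instantiated at each stage. No truth in a model
is needed, so negative literals of the query may lie outside `NegStar`. -/
theorem terminates_of_literals {P : Program L} (hP : WellTypedProgram τ P)
    (h : ∀ l : Literal L ℕ, WellTypedQuery τ [l] → Terminates P [l]) (n : ℕ) :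
    ∀ Q : Query L, Q.length = n → WellTypedQuery τ Q → Terminates P Q := by
  induction n with
  | zero =>
    intro Q hn _
    rw [List.length_eq_zero_iff.1 hn]
    exact terminates_nil
  | succ n ih =>
    intro Q hn hQ
    obtain _ | ⟨l, Q⟩ := Q
    · exact terminates_nil
    · refine Terminates.append (Q₁ := [l]) (h l (wellTypedQuery_singleton.2 hQ.head)) fun θ hθ => ?_
      exact ih _ (by simpa using hn) (hQ.tail_subst hP hθ)

/-- Used for clause bodies: their negative literals lie in `NegStar P`, so answers of each literal
are true and `LevelsBelow` survives for the rest. -/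
theorem terminates_of_levelsBelow {D : Type w} [L.Structure D] [Nonempty D] {P : Program L}
    (hP : WellTypedProgram τ P) (hM : IsCompleteModel D P) {level : LevelMapping L} {n : ℕ}
    (h : ∀ l : Literal L ℕ, WellTypedQuery τ [l] →
      (∀ γ : ℕ → L.Term Empty, level (l.atom.subst γ) < n) → Terminates P [l]) (m : ℕ) :
    ∀ Q : Query L, Q.length = m → WellTypedQuery τ Q → NegsIn (NegStar P) Q →
      LevelsBelow D level n Q → Terminates P Q := by
  induction m with
  | zero =>
    intro Q hm _ _ _
    rw [List.length_eq_zero_iff.1 hm]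
    exact terminates_nil
  | succ m ih =>
    intro Q hm hQ hneg hlev
    obtain _ | ⟨l, Q⟩ := Q
    · exact terminates_nil
    · refine Terminates.append (Q₁ := [l]) (h l (wellTypedQuery_singleton.2 hQ.head) hlev.head)
        fun θ hθ => ?_
      refine ih _ (by simpa using hm) (hQ.tail_subst hP hθ) (hneg.tail.subst θ)
        (hlev.tail_subst fun s => ?_)
      rw [Literal.holds_subst]
      refine hθ.sound hM (fun A hA => hneg A ?_) s l (List.mem_singleton_self l)
      rw [List.mem_singleton.1 hA]
      exact List.mem_cons_self

end LogicProg

/-! ### The main theorem -/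

open LogicProg
theorem corollary2 {L : FirstOrder.Language.{u, v}} [Nonempty L.Constants]
    (τ : Typing L) (P R : Program L) (hP : P.Finite) (hR : R.Finite)
    (hWT : WellTypedProgram τ (P ∪ R)) (hExt : Extends P R)
    (M : Type w) [L.Structure M] (hM : IsCompleteModel M (P ∪ R))
    (level : LevelMapping L) (hAcc : Acceptable M P level)
    (hBdd : ∀ A : Atom L ℕ, WellTypedQuery τ [Literal.pos A] → DefinedIn P A.symbol →
      Bounded level A)
    (hTerm : ∀ Q : Query L, WellTypedQuery τ Q → AllDerivationsFinite R Q) :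
    ∀ Q : Query L, WellTypedQuery τ Q → AllDerivationsFinite (P ∪ R) Q := by
  obtain ⟨a⟩ := ‹Nonempty L.Constants›
  have : Nonempty M := ⟨(a : M)⟩
  have hatom : ∀ l : Literal L ℕ, WellTypedQuery τ [l] → WellTypedQuery τ [.pos l.atom] :=
    fun l hl => wellTypedQuery_singleton.2 fun θ => wellTypedQuery_singleton.1 hl θ
  have undefined : ∀ A : Atom L ℕ, WellTypedQuery τ [.pos A] → ¬ DefinedIn P A.symbol →
      Terminates (P ∪ R) [.pos A] := fun A hA hd =>
    (allDerivationsFinite_iff.1 (hTerm _ hA)).union_of_extends hExt (relsIn_singleton.2 hd)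
  have below : ∀ (n : ℕ) (A : Atom L ℕ), WellTypedQuery τ [.pos A] →
      (∀ γ : ℕ → L.Term Empty, level (A.subst γ) < n) → Terminates (P ∪ R) [.pos A] := by
    intro n
    induction n with
    -- A constant provides a ground instance of `A`, whose level would be negative.
    | zero => exact fun A _ hlev => absurd (hlev fun _ => a.term) (Nat.not_lt_zero _)
    | succ n ih =>
      intro A hA hlev
      by_cases hd : DefinedIn P A.symbol
      · refine Acc.intro _ fun Q' hs => ?_
        cases hs with
        | resolve hr =>
          obtain ⟨σ, c, δ, hr⟩ := hr.exists_resolvesWith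
          have hQ' : Q' = c.body.map fun l => l.subst δ := by simpa using hr.query
          have hc : c ∈ P := hr.mem.resolve_right fun h => by
            rw [← hr.symbol_eq] at hd
            exact hExt _ hd ⟨c, h, Or.inl rfl⟩
          -- Body literals over relations of `R` need no separate treatment: `ih` covers every
          -- well-typed atom, defined in `P` or not.
          refine terminates_of_levelsBelow hWT hM (level := level) (n := n)
            (fun l hl hln => (ih l.atom (hatom l hl) hln).of_atom) _ Q' rfl (hr.wellTyped hWT hA)
            ?_ ?_
          · rw [hQ']
            exact (negsIn_body hr.mem).subst δ
          · rw [hQ']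
            refine hAcc.levelsBelow hc fun γ => ?_
            -- The instantiated head is an instance of `A`, so its ground instances have levels
            -- below `n + 1`, that is, at most `n`.
            rw [← hr.head, Atom.subst_subst]
            exact Nat.le_of_lt_succ (hlev _)
      · exact undefined A hA hd
  intro Q hQ
  refine allDerivationsFinite_iff.2 (terminates_of_literals hWT (fun l hl => ?_) _ Q rfl hQ)
  have hl := hatom l hl
  refine Terminates.of_atom ?_
  by_cases hd : DefinedIn P l.atom.symbol
  · obtain ⟨N, hN⟩ := (hBdd _ hl hd).bddAbove
    exact below (N + 1) _ hl fun γ => Nat.lt_succ_of_le (hN ⟨γ, rfl⟩)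
  · exact undefined _ hl hd
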